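/- For $n\ge 1$ let $B_n$ be the Boolean graph: its vertices are the nonempty proper subsets of $\{1,\dots,n\}$, and two vertices $M,N$ are adjacent if and only if $M\cap N=\varnothing$. For a finite simple graph $G$ let $\Delta_G$ be the clique complex of the complement of $G$, that is, the simplicial complex of independent sets of $G$ (the empty set being a face). A simplicial complex $\Delta$ is vertex decomposable if it is a simplex (all subsets of one finite set, which may be empty), or if it has a vertex $x$ such that both the deletion $\Delta\setminus x=\{F\in\Delta: x\notin F\}$ and the link $\mathrm{lk}_\Delta(x)=\{F\in\Delta: x\notin F,\ F\cup\{x\}\in\Delta\}$ are vertex decomposable and no facet of $\mathrm{lk}_\Delta(x)$ is a facet of $\Delta\setminus x$. A graph $G$ is vertex decomposable if $\Delta_G$ is, and it is Cohen--Macaulay over a field $K$ if the Stanley--Reisner ring $K[\Delta_G]=K[x_v : v\in V(G)]/(x_ux_v : \{u,v\}\in E(G))$ is a Cohen--Macaulay ring. Then for every $n\ge 1$ the graph $B_n$ is vertex decomposable, and it is Cohen--Macaulay over every field $K$. -/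

import Mathlib

universe u v

/-! ## Simplicial complexes and vertex decomposability -/

/-- A simplicial complex on the ambient set `V`: a nonempty hereditary family of finite sets.
The empty set is a face (as is needed for links and facets), and the points of `V` that are not
faces are simply not vertices of the complex, so that deletions and links live on the same `V`. -/
@[ext]
structure FaceComplex (V : Type u) where
  faces : Set (Finset V)
  empty_mem : ∅ ∈ faces
  down_closed : ∀ ⦃F H : Finset V⦄, F ∈ faces → H ⊆ F → H ∈ faces

namespace FaceComplex

variable {V : Type u}

/-- `x` is a vertex of the complex. -/
def IsVertex (Δ : FaceComplex V) (x : V) : Prop := {x} ∈ Δ.faces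

/-- A facet is a face that is maximal under inclusion. -/
def IsFacet (Δ : FaceComplex V) (F : Finset V) : Prop := Maximal (· ∈ Δ.faces) F

/-- The complex is a simplex: it consists of all subsets of one finite set. -/
def IsSimplex (Δ : FaceComplex V) : Prop := ∃ s : Finset V, ∀ F, F ∈ Δ.faces ↔ F ⊆ s

/-- The deletion `Δ \ x = {F ∈ Δ | x ∉ F}`. -/
def deletion (Δ : FaceComplex V) (x : V) : FaceComplex V where
  faces := {F | F ∈ Δ.faces ∧ x ∉ F}
  empty_mem := ⟨Δ.empty_mem, Finset.notMem_empty x⟩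
  down_closed := fun _ _ hF hHF => ⟨Δ.down_closed hF.1 hHF, fun hx => hF.2 (hHF hx)⟩

/-- The link `{F ∈ Δ | x ∉ F, F ∪ {x} ∈ Δ}` of a vertex `x`. -/
def link [DecidableEq V] (Δ : FaceComplex V) (x : V) (hx : Δ.IsVertex x) : FaceComplex V where
  faces := {F | F ∈ Δ.faces ∧ x ∉ F ∧ insert x F ∈ Δ.faces}
  empty_mem := ⟨Δ.empty_mem, Finset.notMem_empty x, hx⟩
  down_closed := fun _ _ hF hHF =>
    ⟨Δ.down_closed hF.1 hHF, fun h => hF.2.1 (hHF h),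
      Δ.down_closed hF.2.2 (Finset.insert_subset_insert x hHF)⟩

/-- Vertex decomposability (not necessarily pure): a simplex is vertex decomposable, and so is a
complex with a vertex whose deletion and link are vertex decomposable and such that no facet of
the link is a facet of the deletion. -/
inductive IsVertexDecomposable [DecidableEq V] : FaceComplex V → Prop
  | simplex (Δ : FaceComplex V) (h : Δ.IsSimplex) : IsVertexDecomposable Δ
  | shedding (Δ : FaceComplex V) (x : V) (hx : Δ.IsVertex x)
      (hdel : IsVertexDecomposable (Δ.deletion x))
      (hlink : IsVertexDecomposable (Δ.link x hx))
      (hshed : ∀ F, (Δ.link x hx).IsFacet F → ¬ (Δ.deletion x).IsFacet F) :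
      IsVertexDecomposable Δ

/-- The Stanley–Reisner ideal in `K[x_v | v ∈ V]`, generated by the squarefree monomials of the
non-faces. -/
noncomputable def stanleyReisnerIdeal (K : Type v) [Field K] (Δ : FaceComplex V) : Ideal (MvPolynomial V K) :=
  Ideal.span {m | ∃ F : Finset V, F ∉ Δ.faces ∧ m = ∏ i ∈ F, MvPolynomial.X i}

/-- The Stanley–Reisner ring `K[Δ]`. -/
abbrev StanleyReisnerRing (K : Type v) [Field K] (Δ : FaceComplex V) : Type (max u v) :=
  MvPolynomial V K ⧸ Δ.stanleyReisnerIdeal K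

end FaceComplex

/-! ## Cohen–Macaulay rings -/

/-- The depth of a local ring: the supremum of the lengths of the regular sequences in its
maximal ideal. -/
noncomputable def localDepth (R : Type u) [CommRing R] [IsLocalRing R] : ℕ∞ :=
  ⨆ rs : {rs : List R // (∀ r ∈ rs, r ∈ IsLocalRing.maximalIdeal R) ∧
    RingTheory.Sequence.IsRegular R rs}, (rs.1.length : ℕ∞)

/-- A Cohen–Macaulay ring: a Noetherian ring all of whose localizations at prime ideals have
depth equal to their Krull dimension. -/
def IsCohenMacaulayRing (R : Type u) [CommRing R] : Prop :=
  IsNoetherianRing R ∧ ∀ (p : Ideal R) [p.IsPrime],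
    ((localDepth (Localization.AtPrime p) : ℕ∞) : WithBot ℕ∞) =
      ringKrullDim (Localization.AtPrime p)

/-! ## Graphs -/

namespace SimpleGraph

variable {V : Type u}

/-- The clique complex of a graph. -/
def cliqueFaceComplex (G : SimpleGraph V) : FaceComplex V where
  faces := {F | G.IsClique (F : Set V)}
  empty_mem := by simp
  down_closed := fun _ _ hF hHF => hF.subset (Finset.coe_subset.mpr hHF)

/-- The complex `Δ_G` of a graph `G`: the clique complex of the complement of `G`, whose faces are
the independent sets of `G`. -/
def indepFaceComplex (G : SimpleGraph V) : FaceComplex V := Gᶜ.cliqueFaceComplex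

/-- A graph is vertex decomposable if `Δ_G` is. -/
def IsVertexDecomposable [DecidableEq V] (G : SimpleGraph V) : Prop :=
  G.indepFaceComplex.IsVertexDecomposable

/-- A graph is Cohen–Macaulay over `K` if the Stanley–Reisner ring `K[Δ_G]` is a Cohen–Macaulay
ring; the Stanley–Reisner ideal of `Δ_G` is the edge ideal of `G`. -/
def IsCohenMacaulayOver (G : SimpleGraph V) (K : Type v) [Field K] : Prop :=
  IsCohenMacaulayRing (G.indepFaceComplex.StanleyReisnerRing K)

end SimpleGraph

/-- The vertices of the Boolean graph: the nonempty proper subsets of an `n`-element set. -/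
abbrev BooleanVertex (n : ℕ) : Type := {A : Finset (Fin n) // A ≠ ∅ ∧ A ≠ Finset.univ}

/-- The Boolean graph `B_n`: two nonempty proper subsets are adjacent when they are disjoint. -/
def booleanGraph (n : ℕ) : SimpleGraph (BooleanVertex n) where
  Adj A B := A.1 ∩ B.1 = ∅
  symm := ⟨fun A B h => by rwa [Finset.inter_comm]⟩
  loopless := ⟨fun A h => A.2.1 (by rwa [Finset.inter_self] at h)⟩

/-! Both claims rest on one induction, `peel_induction`, over vertex sets `W` of the Boolean graph.
If `x` has least cardinality among the members of `W` whose complement is also in `W`, then the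
neighbours of `xᶜ` in `W` are subsets of `x`. A proper one would lack its complement in `W`, hence
be isolated. So `xᶜ` is a leaf attached to `x`. Removing `x`, or removing all neighbours of `x`,
again gives a peeled set (`IsPeeled`). The process ends at independent sets with one member from
each complementary pair.

A neighbour of a leaf is a shedding vertex, and independent sets give simplices; this yields vertex
decomposability.

For the Cohen–Macaulay property, let `S` be the polynomial ring with one variable per pair, acting
by `X A + X Aᶜ`. Multiplication by `x` gives an exact sequence `0 → K[star x] → K[Δ] → K[Δ \ x] →
0`, and at the end of the peeling the ring is `S` itself. Hence `K[Δ]` is projective, so flat, over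
`S`. It is integral because `X A * X Aᶜ = 0`. A Noetherian flat integral extension of a
Cohen–Macaulay ring is Cohen–Macaulay, and `S` is one. Purity is never used. -/

/-! ## Cohen–Macaulay local rings -/

section CohenMacaulayLocal

open IsLocalRing RingTheory.Sequence

/-- A local ring with a weakly regular sequence in its maximal ideal that is at least as long as
its Krull dimension. For Noetherian rings this says that the ring is Cohen–Macaulay. -/
def HasLongRegularSequence (R : Type*) [CommRing R] [IsLocalRing R] : Prop :=
  ∃ rs : List R, (∀ r ∈ rs, r ∈ maximalIdeal R) ∧ IsWeaklyRegular R rs ∧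
    ringKrullDim R ≤ rs.length

theorem HasLongRegularSequence.of_ringEquiv {R S : Type*} [CommRing R] [IsLocalRing R]
    [CommRing S] [IsLocalRing S] (e : R ≃+* S) (h : HasLongRegularSequence R) :
    HasLongRegularSequence S := by
  obtain ⟨rs, hmem, hreg, hdim⟩ := h
  refine ⟨rs.map e, ?_, ?_, ?_⟩
  · intro r hr
    obtain ⟨s, hs, rfl⟩ := List.mem_map.mp hr
    have := hmem s hs
    simpa [mem_maximalIdeal, mem_nonunits_iff] using this
  · let := e.toRingHom.toAlgebra
    have : Module.Flat R S := Module.Flat.of_linearEquiv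
      (LinearEquiv.ofBijective (Algebra.linearMap R S) e.bijective).symm
    exact hreg.of_flat (S := S)
  · simpa [ringKrullDim_eq_of_ringEquiv e] using hdim

theorem localDepth_le_ringKrullDim (R : Type*) [CommRing R] [IsLocalRing R]
    [IsNoetherianRing R] : ((localDepth R : ℕ∞) : WithBot ℕ∞) ≤ ringKrullDim R := by
  rw [← maximalIdeal_height_eq_ringKrullDim, WithBot.coe_le_coe]
  refine iSup_le fun rs => ?_
  have := ringKrullDim_add_length_eq_ringKrullDim_of_isRegular rs.1 rs.2.2
  rw [← WithBot.coe_le_coe, maximalIdeal_height_eq_ringKrullDim, ← this]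
  have hne : Ideal.ofList rs.1 ≠ ⊤ := by simpa using rs.2.2.2.symm
  have : Nontrivial (R ⧸ Ideal.ofList rs.1) := Ideal.Quotient.nontrivial_iff.mpr hne
  have h0 : 0 ≤ ringKrullDim (R ⧸ Ideal.ofList rs.1) := ringKrullDim_nonneg_of_nontrivial
  calc (((rs.1.length : ℕ∞) : WithBot ℕ∞)) = 0 + (rs.1.length : WithBot ℕ∞) := by simp
    _ ≤ _ := by gcongr

theorem localDepth_eq_ringKrullDim_iff (R : Type*) [CommRing R] [IsLocalRing R]
    [IsNoetherianRing R] :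
    ((localDepth R : ℕ∞) : WithBot ℕ∞) = ringKrullDim R ↔ HasLongRegularSequence R := by
  constructor
  · intro h
    have hlt : localDepth R < ⊤ := by
      rw [← maximalIdeal_height_eq_ringKrullDim, WithBot.coe_inj] at h
      rw [h]
      exact Ideal.height_lt_top Ideal.IsPrime.ne_top'
    have : Nonempty {rs : List R // (∀ r ∈ rs, r ∈ maximalIdeal R) ∧ IsRegular R rs} :=
      ⟨⟨[], by simp, IsRegular.nil R R⟩⟩
    obtain ⟨rs, hrs⟩ := ENat.exists_eq_iSup_of_lt_top hlt
    refine ⟨rs.1, rs.2.1, rs.2.2.1, ?_⟩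
    rw [← h, localDepth, ← hrs]
    rfl
  · rintro ⟨rs, hmem, hreg, hdim⟩
    refine le_antisymm (localDepth_le_ringKrullDim R) (hdim.trans ?_)
    have := le_iSup (fun rs : {rs : List R // (∀ r ∈ rs, r ∈ maximalIdeal R) ∧ IsRegular R rs} =>
      (rs.1.length : ℕ∞)) ⟨rs, hmem,
        (isRegular_iff_isWeaklyRegular_of_subset_maximalIdeal hmem).mpr hreg⟩
    exact WithBot.coe_le_coe.mpr this

theorem isCohenMacaulayRing_iff (R : Type*) [CommRing R] [IsNoetherianRing R] :
    IsCohenMacaulayRing R ↔ ∀ (p : Ideal R) [p.IsPrime],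
      HasLongRegularSequence (Localization.AtPrime p) := by
  simp only [IsCohenMacaulayRing, localDepth_eq_ringKrullDim_iff, and_iff_right_iff_imp]
  intro _
  infer_instance

theorem IsCohenMacaulayRing.of_ringEquiv {R S : Type*} [CommRing R] [CommRing S] (e : R ≃+* S)
    (h : IsCohenMacaulayRing R) : IsCohenMacaulayRing S := by
  have := h.1
  have := isNoetherianRing_of_ringEquiv R e
  rw [isCohenMacaulayRing_iff] at h ⊢
  intro p hp
  exact (h (p.comap e)).of_ringEquiv <| IsLocalization.ringEquivOfRingEquiv
    (Localization.AtPrime (p.comap e)) (Localization.AtPrime p) e (e.map_primeCompl_comap_eq p)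

theorem Field.isCohenMacaulayRing (K : Type*) [Field K] : IsCohenMacaulayRing K := by
  rw [isCohenMacaulayRing_iff]
  intro p hp
  refine ⟨[], by simp, IsWeaklyRegular.nil _ _, ?_⟩
  rw [IsLocalization.AtPrime.ringKrullDim_eq_height p]
  refine (Ideal.height_le_ringKrullDim_of_ne_top hp.ne_top).trans ?_
  simp

end CohenMacaulayLocal

/-! ## Flat integral extensions and polynomial extensions -/

section CohenMacaulayExtensions

open IsLocalRing RingTheory.Sequence Polynomial Ideal

/-- Incomparability makes contraction strictly monotone on spectra, so chains of primes stay strict.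
-/
theorem Ideal.height_le_height_under_of_isIntegral {A R : Type*} [CommRing A] [CommRing R]
    [Algebra A R] [Algebra.IsIntegral A R] (p : Ideal R) [p.IsPrime] :
    p.height ≤ (p.under A).height := by
  have hmono : StrictMono (PrimeSpectrum.comap (algebraMap A R)) := fun I J hIJ =>
    Ideal.IsIntegral.comap_lt_comap (R := A) (I := I.asIdeal) (J := J.asIdeal) hIJ
  have := Order.height_le_height_apply_of_strictMono _ hmono ⟨p, ‹_›⟩
  rwa [← PrimeSpectrum.height_eq_orderHeight, ← PrimeSpectrum.height_eq_orderHeight] at this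

theorem isWeaklyRegular_localization_of_flat {A R : Type*} [CommRing A] [CommRing R]
    [Algebra A R] [Module.Flat A R] (q : Ideal A) [q.IsPrime] (p : Ideal R) [p.IsPrime]
    [p.LiesOver q] {rs : List (Localization.AtPrime q)}
    (hmem : ∀ r ∈ rs, r ∈ maximalIdeal (Localization.AtPrime q))
    (hreg : IsWeaklyRegular (Localization.AtPrime q) rs) :
    ∃ ss : List (Localization.AtPrime p), ss.length = rs.length ∧
      (∀ s ∈ ss, s ∈ maximalIdeal (Localization.AtPrime p)) ∧
      IsWeaklyRegular (Localization.AtPrime p) ss := by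
  let := Localization.AtPrime.algebraOfLiesOver q p
  refine ⟨rs.map (algebraMap _ _), by simp, ?_, hreg.of_flat⟩
  intro s hs
  obtain ⟨r, hr, rfl⟩ := List.mem_map.mp hs
  exact map_nonunit (algebraMap (Localization.AtPrime q) (Localization.AtPrime p)) r (hmem r hr)

/-- Flatness carries a regular sequence up to the localization at `p`, and integrality keeps the
height of `p` from exceeding its length. -/
theorem IsCohenMacaulayRing.of_flat_of_isIntegral {A R : Type*} [CommRing A] [CommRing R]
    [Algebra A R] [IsNoetherianRing R] [Module.Flat A R] [Algebra.IsIntegral A R]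
    (h : IsCohenMacaulayRing A) : IsCohenMacaulayRing R := by
  have := h.1
  rw [isCohenMacaulayRing_iff] at h ⊢
  intro p hp
  obtain ⟨rs, hmem, hreg, hdim⟩ := h (p.under A)
  obtain ⟨ss, hlen, hmem', hreg'⟩ :=
    isWeaklyRegular_localization_of_flat (p.under A) p hmem hreg
  refine ⟨ss, hmem', hreg', ?_⟩
  rw [IsLocalization.AtPrime.ringKrullDim_eq_height p, hlen]
  rw [IsLocalization.AtPrime.ringKrullDim_eq_height (p.under A)] at hdim
  exact (WithBot.coe_le_coe.mpr p.height_le_height_under_of_isIntegral).trans hdim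

theorem Polynomial.isSMulRegular_quotient_map_C_of_monic {R : Type*} [CommRing R] (I : Ideal R)
    {y : R[X]} (hy : y.Monic) : IsSMulRegular (R[X] ⧸ I.map C) y := by
  refine isSMulRegular_iff_right_eq_zero_of_smul.mpr fun g hg => ?_
  obtain ⟨g, rfl⟩ := Ideal.Quotient.mk_surjective g
  change Ideal.Quotient.mk _ (y * g) = 0 at hg
  rw [Ideal.Quotient.eq_zero_iff_mem] at hg ⊢
  have hker : ∀ f : R[X], f ∈ I.map C ↔ f.map (Ideal.Quotient.mk I) = 0 := by
    intro f
    have := Polynomial.ker_mapRingHom (Ideal.Quotient.mk I)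
    rw [Ideal.mk_ker] at this
    rw [← this, RingHom.mem_ker, coe_mapRingHom]
  rw [hker] at hg ⊢
  rw [Polynomial.map_mul] at hg
  exact (hy.map _).mul_right_eq_zero_iff.mp hg

/-- The fibre over the closed point is a polynomial ring over a field. Thus `p` is either extended
from the maximal ideal or needs one more generator, a monic polynomial, which prolongs the regular
sequence by one as the height grows by at most one. -/
theorem Polynomial.hasLongRegularSequence_localization_atPrime {R : Type*} [CommRing R]
    [IsLocalRing R] [IsNoetherianRing R] (h : HasLongRegularSequence R) (p : Ideal R[X])
    [p.IsPrime] (hp : p.comap C = maximalIdeal R) :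
    HasLongRegularSequence (Localization.AtPrime p) := by
  obtain ⟨rs, hmem, hreg, hdim⟩ := h
  have hreg' : IsWeaklyRegular R[X] (rs.map C) := hreg.of_flat (S := R[X])
  have hmem' : ∀ r ∈ rs.map C, r ∈ p := by
    intro r hr
    obtain ⟨s, hs, rfl⟩ := List.mem_map.mp hr
    have := hmem s hs
    rwa [← hp] at this
  have : p.LiesOver (maximalIdeal R) := ⟨hp.symm⟩
  have hht := Ideal.height_le_height_add_of_liesOver (maximalIdeal R) p
  rw [← maximalIdeal_height_eq_ringKrullDim] at hdim
  have hdim' : (maximalIdeal R).height ≤ rs.length := by exact_mod_cast hdim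
  have key : ∃ ss : List R[X], (∀ s ∈ ss, s ∈ p) ∧ IsWeaklyRegular R[X] ss ∧
      p.height ≤ ss.length := by
    by_cases heq : p = (p.comap C).map C
    · refine ⟨rs.map C, hmem', hreg', ?_⟩
      have h0 : p.map (Ideal.Quotient.mk ((maximalIdeal R).map (algebraMap R R[X]))) = ⊥ := by
        rw [Ideal.map_eq_bot_iff_le_ker, Ideal.mk_ker, algebraMap_eq, ← hp, ← heq]
      have : Nontrivial (R[X] ⧸ ((maximalIdeal R).map (algebraMap R R[X]))) := by
        rw [Ideal.Quotient.nontrivial_iff, algebraMap_eq, ← hp, ← heq]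
        exact Ideal.IsPrime.ne_top'
      rw [h0, Ideal.height_bot, add_zero] at hht
      simpa using hht.trans hdim'
    · obtain ⟨y, hy, hpy⟩ := Polynomial.exists_monic_span_sup_map_eq R p
        (by rw [hp]; exact maximalIdeal.isMaximal R) heq
      have hyp : y ∈ p := by
        rw [hpy]; exact Ideal.mem_sup_right (Ideal.mem_span_singleton_self y)
      refine ⟨rs.map C ++ [y], ?_, ?_, ?_⟩
      · intro s hs
        rcases List.mem_append.mp hs with hs | hs
        · exact hmem' s hs
        · rwa [List.mem_singleton.mp hs]
      · rw [isWeaklyRegular_append_iff]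
        refine ⟨hreg', ?_⟩
        rw [isWeaklyRegular_singleton_iff, ← Ideal.map_ofList, smul_eq_mul, Ideal.mul_top]
        exact Polynomial.isSMulRegular_quotient_map_C_of_monic (Ideal.ofList rs) hy
      · refine hht.trans ?_
        simp only [List.length_append, List.length_map, List.length_cons, List.length_nil,
          zero_add, Nat.cast_add, Nat.cast_one]
        refine add_le_add hdim' ?_
        set mk := Ideal.Quotient.mk ((maximalIdeal R).map (algebraMap R R[X]))
        have hspan : p.map mk = Ideal.span {mk y} := by
          have h1 : ((maximalIdeal R).map C).map mk = ⊥ := by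
            rw [Ideal.map_eq_bot_iff_le_ker, Ideal.mk_ker, algebraMap_eq]
          conv_lhs => rw [hpy, hp, Ideal.map_sup, h1, bot_sup_eq, Ideal.map_span,
            Set.image_singleton]
        have hne : p.map mk ≠ ⊤ := by
          refine (Ideal.map_isPrime_of_surjective Ideal.Quotient.mk_surjective ?_).ne_top
          rw [Ideal.mk_ker, algebraMap_eq, ← hp]
          exact Ideal.map_comap_le
        -- Krull's height theorem: in the fibre, `p` becomes principal.
        refine (Ideal.height_le_spanFinrank _ hne).trans ?_
        rw [hspan]
        have hle : (Ideal.span {mk y}).spanFinrank ≤ Set.ncard {mk y} :=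
          Submodule.spanFinrank_span_le_ncard_of_finite (Set.finite_singleton (mk y))
        rw [Set.ncard_singleton] at hle
        exact_mod_cast hle
  obtain ⟨ss, hss, hsreg, hsdim⟩ := key
  have hloc := hsreg.isRegular_of_isLocalization_of_mem (Localization.AtPrime p) p hss
  refine ⟨ss.map (algebraMap _ _), ?_, hloc.1, ?_⟩
  · intro r hr
    obtain ⟨s, hs, rfl⟩ := List.mem_map.mp hr
    exact (IsLocalization.AtPrime.to_map_mem_maximal_iff _ p s).mpr (hss s hs)
  · rw [IsLocalization.AtPrime.ringKrullDim_eq_height p, List.length_map]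
    exact_mod_cast hsdim

theorem Polynomial.isCohenMacaulayRing {R : Type*} [CommRing R] (h : IsCohenMacaulayRing R) :
    IsCohenMacaulayRing R[X] := by
  have := h.1
  rw [isCohenMacaulayRing_iff] at h ⊢
  intro p hp
  -- Localizing the coefficients at `q` reduces to a local base ring whose maximal ideal is the
  -- contraction of the prime.
  let q := p.comap C
  let S := (Localization.AtPrime q)[X]
  let pc := Submonoid.map Polynomial.C.toMonoidHom q.primeCompl
  let : Algebra R[X] S := algebra R (Localization.AtPrime q)
  have : IsLocalization pc S := Polynomial.isLocalization _ _
  let pS := p.map (algebraMap R[X] S)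
  have disj : Disjoint (pc : Set R[X]) (p : Set R[X]) := by
    simpa [pc, q] using! Set.disjoint_image_left.mpr
      (Set.disjoint_compl_left_iff_subset.mpr (fun _ a ↦ a))
  have : pS.IsPrime := IsLocalization.isPrime_of_isPrime_disjoint pc _ _ ‹_› disj
  have : IsLocalization.AtPrime (Localization.AtPrime pS) p := by
    convert IsLocalization.isLocalization_isLocalization_atPrime_isLocalization pc
      (Localization.AtPrime pS) pS
    exact (IsLocalization.under_map_of_isPrime_disjoint pc _ ‹_› disj).symm
  have eq : comap C pS = maximalIdeal (Localization.AtPrime q) := by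
    rw [← IsLocalization.map_under q.primeCompl _ (comap C pS),
      ← IsLocalization.map_under q.primeCompl _ (maximalIdeal (Localization.AtPrime q))]
    simp only [comap_comap, S, pS]
    rw [← Polynomial.algebraMap_eq (R := Localization.AtPrime q),
      ← IsScalarTower.algebraMap_eq R (Localization.AtPrime q) (Localization.AtPrime q)[X],
      IsScalarTower.algebraMap_eq R R[X] (Localization.AtPrime q)[X], ← comap_comap,
      ← Ideal.under_def R[X], IsLocalization.under_map_of_isPrime_disjoint pc _ ‹_› disj]
    simp [q, IsLocalization.AtPrime.under_maximalIdeal (Localization.AtPrime q) q]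
  exact (hasLongRegularSequence_localization_atPrime (h q) pS eq).of_ringEquiv
    (IsLocalization.algEquiv p.primeCompl
      (Localization.AtPrime pS) (Localization.AtPrime p)).toRingEquiv

theorem MvPolynomial.isCohenMacaulayRing {R : Type*} [CommRing R] (h : IsCohenMacaulayRing R)
    (ι : Type*) [Finite ι] : IsCohenMacaulayRing (MvPolynomial ι R) := by
  induction ι using Finite.induction_empty_option with
  | of_equiv e H => exact H.of_ringEquiv (renameEquiv _ e).toRingEquiv
  | h_empty => exact h.of_ringEquiv (isEmptyRingEquiv R _).symm
  | h_option IH =>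
    exact (Polynomial.isCohenMacaulayRing IH).of_ringEquiv
      (MvPolynomial.optionEquivLeft _ _).toRingEquiv.symm

end CohenMacaulayExtensions

/-! ## Independence complexes of induced subgraphs -/

namespace SimpleGraph

variable {V : Type u} (G : SimpleGraph V)

/-- The complex of the independent sets of `G` that are contained in `W`. -/
def indepFaceComplexOn (W : Finset V) : FaceComplex V where
  faces := {F | F ⊆ W ∧ ∀ a ∈ F, ∀ b ∈ F, ¬ G.Adj a b}
  empty_mem := by simp
  down_closed := fun _ _ hF hHF =>
    ⟨hHF.trans hF.1, fun a ha b hb => hF.2 a (hHF ha) b (hHF hb)⟩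

variable {G} in
theorem mem_indepFaceComplexOn {W F : Finset V} : F ∈ (G.indepFaceComplexOn W).faces ↔
    F ⊆ W ∧ ∀ a ∈ F, ∀ b ∈ F, ¬ G.Adj a b := Iff.rfl

theorem indepFaceComplex_eq_indepFaceComplexOn_univ [Fintype V] :
    G.indepFaceComplex = G.indepFaceComplexOn Finset.univ := by
  ext F
  simp only [mem_indepFaceComplexOn, Finset.subset_univ, true_and]
  change Gᶜ.IsClique (F : Set V) ↔ _
  rw [isClique_compl]
  constructor
  · intro h a ha b hb hab
    exact h ha hb hab.ne hab
  · intro h a ha b hb _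
    exact h a ha b hb

variable [DecidableEq V]

theorem deletion_indepFaceComplexOn (W : Finset V) (x : V) :
    (G.indepFaceComplexOn W).deletion x = G.indepFaceComplexOn (W.erase x) := by
  ext F
  change F ∈ (G.indepFaceComplexOn W).faces ∧ x ∉ F ↔ _
  simp only [mem_indepFaceComplexOn, Finset.subset_erase]
  tauto

variable [DecidableRel G.Adj]

/-- The filtered set retains `x`, so its complex is the star of `x`, not the link. -/
theorem insert_mem_indepFaceComplexOn {W F : Finset V} {x : V} (hx : x ∈ W) :
    insert x F ∈ (G.indepFaceComplexOn W).faces ↔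
      F ∈ (G.indepFaceComplexOn (W.filter (¬ G.Adj x ·))).faces := by
  simp only [mem_indepFaceComplexOn, hx, true_and, Finset.subset_iff,
    Finset.mem_filter, Finset.mem_insert, forall_eq_or_imp, G.loopless.irrefl x,
    not_false_eq_true]
  constructor
  · rintro ⟨hW, h1, h2⟩
    exact ⟨fun z hz => ⟨hW z hz, h1 z hz⟩, fun a ha b hb => (h2 a ha).2 b hb⟩
  · rintro ⟨hW, h2⟩
    exact ⟨fun z hz => (hW hz).1, fun z hz => (hW hz).2,
      fun a ha => ⟨fun h => (hW ha).2 h.symm, fun b hb => h2 a ha b hb⟩⟩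

theorem link_indepFaceComplexOn {W : Finset V} {x : V} (hx : x ∈ W)
    (hv : (G.indepFaceComplexOn W).IsVertex x) :
    (G.indepFaceComplexOn W).link x hv =
      G.indepFaceComplexOn ((W.filter (¬ G.Adj x ·)).erase x) := by
  ext F
  change F ∈ (G.indepFaceComplexOn W).faces ∧ x ∉ F ∧ insert x F ∈ (G.indepFaceComplexOn W).faces
    ↔ _
  rw [insert_mem_indepFaceComplexOn G hx]
  simp only [mem_indepFaceComplexOn, Finset.subset_erase]
  have : F ⊆ W.filter (¬ G.Adj x ·) → F ⊆ W := fun h => h.trans (Finset.filter_subset _ _)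
  tauto

/-- A vertex with a neighbour that has no other neighbour in `W` is a shedding vertex. -/
theorem isVertexDecomposable_indepFaceComplexOn_of_leaf {W : Finset V} {x y : V} (hx : x ∈ W)
    (hy : y ∈ W) (hxy : G.Adj x y) (hleaf : ∀ z ∈ W, G.Adj z y → z = x)
    (hdel : (G.indepFaceComplexOn (W.erase x)).IsVertexDecomposable)
    (hlink : (G.indepFaceComplexOn
      ((W.filter (¬ G.Adj x ·)).erase x)).IsVertexDecomposable) :
    (G.indepFaceComplexOn W).IsVertexDecomposable := by
  have hv : (G.indepFaceComplexOn W).IsVertex x := by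
    simp [FaceComplex.IsVertex, mem_indepFaceComplexOn, hx]
  refine .shedding _ x hv (by rwa [deletion_indepFaceComplexOn])
    (by rwa [link_indepFaceComplexOn G hx]) ?_
  rw [link_indepFaceComplexOn G hx, deletion_indepFaceComplexOn]
  intro F hF hF'
  have hyF : y ∉ F := by
    intro h
    have := hF.prop.1 h
    simp [hxy] at this
  -- The leaf `y` can be added to `F` inside the deletion, since its only neighbour is `x`.
  refine hyF (hF'.le_of_ge (y := insert y F) ?_ (Finset.subset_insert y F)
    (Finset.mem_insert_self y F))
  have hFW := hF'.prop
  have hz : ∀ z ∈ F, ¬ G.Adj z y := by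
    intro z hz h
    have hzW := Finset.mem_erase.mp (hFW.1 hz)
    exact hzW.1 (hleaf z hzW.2 h)
  rw [mem_indepFaceComplexOn]
  refine ⟨Finset.insert_subset (Finset.mem_erase.mpr ⟨hxy.ne', hy⟩) hFW.1, ?_⟩
  intro a ha b hb hab
  rcases Finset.mem_insert.mp ha with ha' | ha' <;> rcases Finset.mem_insert.mp hb with hb' | hb'
  · exact hab.ne (ha'.trans hb'.symm)
  · exact hz b hb' (ha' ▸ hab.symm)
  · exact hz a ha' (hb' ▸ hab)
  · exact hFW.2 a ha' b hb' hab

end SimpleGraph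

/-! ## Peeling the Boolean graph -/

namespace BooleanVertex

variable {n : ℕ}

/-- The complement of a nonempty proper subset. -/
def compl (A : BooleanVertex n) : BooleanVertex n :=
  ⟨A.1ᶜ, by simpa [Finset.compl_eq_empty_iff] using A.2.2,
    by simpa [Finset.compl_eq_univ_iff] using A.2.1⟩

@[simp] theorem compl_compl (A : BooleanVertex n) : A.compl.compl = A :=
  Subtype.ext (_root_.compl_compl A.1)

theorem compl_ne (A : BooleanVertex n) : A.compl ≠ A := by
  intro h
  obtain ⟨i, hi⟩ := Finset.nonempty_iff_ne_empty.mpr A.2.1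
  have hi' : i ∈ A.compl.1 := by rwa [h]
  exact (Finset.mem_compl.mp hi') hi

end BooleanVertex

namespace booleanGraph

variable {n : ℕ}

instance : DecidableRel (booleanGraph n).Adj :=
  fun A B => inferInstanceAs (Decidable (A.1 ∩ B.1 = ∅))

theorem adj_iff_disjoint {A B : BooleanVertex n} :
    (booleanGraph n).Adj A B ↔ Disjoint A.1 B.1 :=
  Finset.disjoint_iff_inter_eq_empty.symm

theorem adj_compl_iff {A B : BooleanVertex n} :
    (booleanGraph n).Adj A B.compl ↔ A.1 ⊆ B.1 := by
  rw [adj_iff_disjoint]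
  exact disjoint_compl_right_iff

theorem adj_compl_self (A : BooleanVertex n) : (booleanGraph n).Adj A A.compl :=
  adj_compl_iff.mpr subset_rfl

/-- A set of vertices that meets every complementary pair, and in which every vertex without its
complement is isolated. -/
def IsPeeled (W : Finset (BooleanVertex n)) : Prop :=
  (∀ A, A ∈ W ∨ A.compl ∈ W) ∧
    ∀ A ∈ W, A.compl ∉ W → ∀ B ∈ W, ¬ (booleanGraph n).Adj A B

theorem IsPeeled.erase {W : Finset (BooleanVertex n)} (hW : IsPeeled W) {x : BooleanVertex n}
    (hx' : x.compl ∈ W)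
    (hleaf : ∀ z ∈ W, (booleanGraph n).Adj z x.compl → z = x) : IsPeeled (W.erase x) := by
  constructor
  · intro A
    by_cases hA : A = x
    · exact Or.inr (Finset.mem_erase.mpr ⟨by rw [hA]; exact x.compl_ne, by rwa [hA]⟩)
    · by_cases hA' : A.compl = x
      · refine Or.inl (Finset.mem_erase.mpr ⟨hA, ?_⟩)
        rwa [← hA', BooleanVertex.compl_compl] at hx'
      · simpa [hA, hA'] using hW.1 A
  · intro A hA hA' B hB hAB
    rw [Finset.mem_erase] at hA hB
    by_cases h : A.compl ∈ W
    · have hAx : A.compl = x := by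
        by_contra hne
        exact hA' (Finset.mem_erase.mpr ⟨hne, h⟩)
      have : A = x.compl := by rw [← hAx, BooleanVertex.compl_compl]
      rw [this] at hAB
      exact hB.1 (hleaf B hB.2 hAB.symm)
    · exact hW.2 A hA.2 h B hB.2 hAB

/-- A removed `A` is disjoint from `x`, so `Aᶜ` contains `x` and stays. If instead `Aᶜ` is removed,
then `x ⊆ A`, so every neighbour of `A` is disjoint from `x` and is removed too. -/
theorem IsPeeled.filter {W : Finset (BooleanVertex n)} (hW : IsPeeled W) {x : BooleanVertex n}
    (hx : x ∈ W) : IsPeeled (W.filter (¬ (booleanGraph n).Adj x ·)) := by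
  have key : ∀ A, A ∈ W → (booleanGraph n).Adj x A →
      A.compl ∈ W.filter (¬ (booleanGraph n).Adj x ·) := by
    intro A hA hxA
    have h1 : A.compl ∈ W := by
      by_contra h
      exact hW.2 A hA h x hx hxA.symm
    refine Finset.mem_filter.mpr ⟨h1, fun h2 => x.2.1 ?_⟩
    exact Finset.disjoint_self_iff_empty _ |>.mp
      ((adj_iff_disjoint.mp hxA).symm.mono_left (adj_compl_iff.mp h2))
  constructor
  · intro A
    by_contra! h
    rcases hW.1 A with hA | hA
    · by_cases hxA : (booleanGraph n).Adj x A
      · exact h.2 (key A hA hxA)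
      · exact h.1 (Finset.mem_filter.mpr ⟨hA, hxA⟩)
    · by_cases hxA : (booleanGraph n).Adj x A.compl
      · exact h.1 (by simpa using key _ hA hxA)
      · exact h.2 (Finset.mem_filter.mpr ⟨hA, hxA⟩)
  · intro A hA hA' B hB hAB
    rw [Finset.mem_filter] at hA hB
    by_cases h : A.compl ∈ W
    · have hxA : (booleanGraph n).Adj x A.compl := by
        by_contra hne
        exact hA' (Finset.mem_filter.mpr ⟨h, hne⟩)
      exact hB.2 (adj_iff_disjoint.mpr
        ((adj_iff_disjoint.mp hAB).mono_left (adj_compl_iff.mp hxA)))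
    · exact hW.2 A hA.1 h B hB.1 hAB

/-- Induction over the peeled vertex sets of the Boolean graph: the induced subgraphs arise from
independent transversals of the complementary pairs by adding a neighbour of a leaf. -/
theorem peel_induction {motive : Finset (BooleanVertex n) → Prop}
    (transversal : ∀ W, (∀ A, A ∈ W ↔ A.compl ∉ W) →
      (∀ A ∈ W, ∀ B ∈ W, ¬ (booleanGraph n).Adj A B) → motive W)
    (leaf : ∀ W x, x ∈ W → x.compl ∈ W →
      (∀ z ∈ W, (booleanGraph n).Adj z x.compl → z = x) →
      motive (W.erase x) → motive (W.filter (¬ (booleanGraph n).Adj x ·)) → motive W) :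
    motive Finset.univ := by
  suffices h : ∀ W, IsPeeled W → motive W from
    h _ ⟨fun A => Or.inl (Finset.mem_univ A), fun A _ h => (h (Finset.mem_univ _)).elim⟩
  intro W
  induction W using Finset.strongInduction with
  | H W ih =>
    intro hW
    by_cases hpair : ∃ A, A ∈ W ∧ A.compl ∈ W
    · obtain ⟨x, hxmem, hmin⟩ := Finset.exists_min_image (W.filter (·.compl ∈ W))
        (fun A => A.1.card) (hpair.imp fun A hA => Finset.mem_filter.mpr hA)
      obtain ⟨hx, hx'⟩ := Finset.mem_filter.mp hxmem
      have hleaf : ∀ z ∈ W, (booleanGraph n).Adj z x.compl → z = x := by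
        intro z hz hadj
        have hz' : z.compl ∈ W := by
          by_contra h
          exact hW.2 z hz h _ hx' hadj
        exact Subtype.ext (Finset.eq_of_subset_of_card_le (adj_compl_iff.mp hadj)
          (hmin z (Finset.mem_filter.mpr ⟨hz, hz'⟩)))
      refine leaf W x hx hx' hleaf (ih _ (Finset.erase_ssubset hx) (hW.erase hx' hleaf))
        (ih _ ?_ (hW.filter hx))
      exact Finset.filter_ssubset.mpr ⟨x.compl, hx', by simpa using adj_compl_self x⟩
    · push Not at hpair
      refine transversal W (fun A => ⟨hpair A, fun h => (hW.1 A).resolve_right h⟩) ?_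
      exact fun A hA B hB => hW.2 A hA (hpair A hA) B hB

theorem isVertexDecomposable (n : ℕ) : (booleanGraph n).IsVertexDecomposable := by
  rw [SimpleGraph.IsVertexDecomposable,
    SimpleGraph.indepFaceComplex_eq_indepFaceComplexOn_univ]
  -- The induction supplies stars, but shedding needs links, which omit the cone point `x`. The
  -- statement is therefore proved for every `U` obtained from `W` by dropping isolated vertices.
  suffices h : ∀ U ⊆ (Finset.univ : Finset (BooleanVertex n)),
      (∀ A ∈ Finset.univ, A ∉ U → ∀ B ∈ Finset.univ, ¬ (booleanGraph n).Adj A B) →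
      ((booleanGraph n).indepFaceComplexOn U).IsVertexDecomposable from
    h _ subset_rfl (fun A hA hA' => (hA' hA).elim)
  refine peel_induction (n := n) (motive := fun W => ∀ U ⊆ W,
    (∀ A ∈ W, A ∉ U → ∀ B ∈ W, ¬ (booleanGraph n).Adj A B) →
      ((booleanGraph n).indepFaceComplexOn U).IsVertexDecomposable) ?_ ?_
  · intro W _ hind U hU _
    refine .simplex _ ⟨U, fun F => ?_⟩
    rw [SimpleGraph.mem_indepFaceComplexOn]
    exact ⟨fun h => h.1, fun h => ⟨h, fun a ha b hb => hind a (hU (h ha)) b (hU (h hb))⟩⟩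
  · intro W x hx hx' hleaf hdel hstar U hU hiso
    have hxU : x ∈ U := by
      by_contra h
      exact hiso x hx h _ hx' (adj_compl_self x)
    have hxU' : x.compl ∈ U := by
      by_contra h
      exact hiso _ hx' h _ hx (adj_compl_self x).symm
    refine SimpleGraph.isVertexDecomposable_indepFaceComplexOn_of_leaf _ hxU hxU'
      (adj_compl_self x) (fun z hz => hleaf z (hU hz)) (hdel _ (Finset.erase_subset_erase x hU) ?_)
      (hstar _ ((Finset.erase_subset _ _).trans (Finset.filter_subset_filter _ hU)) ?_)
    · intro A hA hAU B hB
      rw [Finset.mem_erase] at hA hB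
      exact hiso A hA.2 (fun h => hAU (Finset.mem_erase.mpr ⟨hA.1, h⟩)) B hB.2
    · intro A hA hAU B hB
      rw [Finset.mem_filter] at hA hB
      by_cases hAx : A = x
      · rw [hAx]
        exact hB.2
      · exact hiso A hA.1
          (fun h => hAU (Finset.mem_erase.mpr ⟨hAx, Finset.mem_filter.mpr ⟨h, hA.2⟩⟩)) B hB.1

end booleanGraph

/-! ## Stanley–Reisner rings as modules over a coefficient algebra -/

theorem Module.Projective.of_exact {A M N P : Type*} [Ring A] [AddCommGroup M]
    [AddCommGroup N] [AddCommGroup P] [Module A M] [Module A N] [Module A P]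
    [Module.Projective A M] [Module.Projective A P] {f : M →ₗ[A] N} {g : N →ₗ[A] P}
    (hf : Function.Injective f) (hfg : Function.Exact f g) (hg : Function.Surjective g) :
    Module.Projective A N := by
  obtain ⟨l, hl⟩ := Module.projective_lifting_property g LinearMap.id hg
  obtain ⟨e, -, -⟩ := hfg.splitSurjectiveEquiv hf ⟨l, hl⟩
  exact Module.Projective.of_equiv e.symm

namespace FaceComplex

open MvPolynomial

variable {V : Type u} {K : Type v} [Field K]

/-- The ideal is monomial, and a squarefree generator divides a monomial exactly when its set lies
in the support. -/
theorem mem_stanleyReisnerIdeal_iff {Δ : FaceComplex V} {f : MvPolynomial V K} :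
    f ∈ Δ.stanleyReisnerIdeal K ↔ ∀ m ∈ f.support, m.support ∉ Δ.faces := by
  classical
  have hgen : {m : MvPolynomial V K | ∃ F : Finset V, F ∉ Δ.faces ∧ m = ∏ i ∈ F, X i} =
      (fun s => monomial s (1 : K)) ''
        {s | ∃ F : Finset V, F ∉ Δ.faces ∧ s = ∑ i ∈ F, Finsupp.single i 1} := by
    have hmon : ∀ F : Finset V, (∏ i ∈ F, X i : MvPolynomial V K) =
        monomial (∑ i ∈ F, Finsupp.single i 1) 1 := fun F => by
      rw [monomial_sum_one]
      rfl
    ext m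
    constructor
    · rintro ⟨F, hF, rfl⟩
      exact ⟨_, ⟨F, hF, rfl⟩, (hmon F).symm⟩
    · rintro ⟨_, ⟨F, hF, rfl⟩, rfl⟩
      exact ⟨F, hF, (hmon F).symm⟩
  have happly : ∀ (F : Finset V) (j : V),
      (∑ i ∈ F, Finsupp.single i 1 : V →₀ ℕ) j = if j ∈ F then 1 else 0 := by
    intro F j
    simp [Finsupp.finsetSum_apply, Finsupp.single_apply]
  have hle : ∀ (F : Finset V) (m : V →₀ ℕ),
      ∑ i ∈ F, Finsupp.single i 1 ≤ m ↔ F ⊆ m.support := by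
    intro F m
    rw [Finsupp.le_def]
    constructor
    · intro h i hi
      have := h i
      rw [happly, if_pos hi] at this
      exact Finsupp.mem_support_iff.mpr (by lia)
    · intro h i
      rw [happly]
      split_ifs with hi
      · exact Nat.one_le_iff_ne_zero.mpr (Finsupp.mem_support_iff.mp (h hi))
      · exact Nat.zero_le _
  rw [stanleyReisnerIdeal, hgen, mem_ideal_span_monomial_image]
  refine forall₂_congr fun m _ => ?_
  constructor
  · rintro ⟨_, ⟨F, hF, rfl⟩, hFm⟩ hm
    exact hF (Δ.down_closed hm ((hle F m).mp hFm))
  · intro hm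
    exact ⟨_, ⟨m.support, hm, rfl⟩, (hle _ m).mpr subset_rfl⟩

theorem X_mul_mem_stanleyReisnerIdeal_iff [DecidableEq V] {Δ : FaceComplex V} {x : V}
    {f : MvPolynomial V K} : X x * f ∈ Δ.stanleyReisnerIdeal K ↔
      ∀ m ∈ f.support, insert x m.support ∉ Δ.faces := by
  have hsupp : ∀ m : V →₀ ℕ, (Finsupp.single x 1 + m).support = insert x m.support := by
    intro m
    ext i
    by_cases hi : i = x
    · simp [hi]
    · simp [hi]
  rw [mem_stanleyReisnerIdeal_iff, support_X_mul]
  simp [hsupp]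

/-- The annihilator of `X x` in `K[Δ]` is the ideal of the star `T`, and killing `X x` gives the
deletion `D`. The resulting short exact sequence splits over `A`. -/
theorem projective_stanleyReisnerRing_of_star_of_deletion [DecidableEq V]
    (A : Type*) [CommRing A] [Algebra A (MvPolynomial V K)] {Δ T D : FaceComplex V} (x : V)
    (hT : ∀ F, F ∈ T.faces ↔ insert x F ∈ Δ.faces)
    (hD : ∀ F, F ∈ D.faces ↔ F ∈ Δ.faces ∧ x ∉ F)
    [Module.Projective A (T.StanleyReisnerRing K)] [Module.Projective A (D.StanleyReisnerRing K)] :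
    Module.Projective A (Δ.StanleyReisnerRing K) := by
  have hstar : ∀ f : MvPolynomial V K,
      X x * f ∈ Δ.stanleyReisnerIdeal K ↔ f ∈ T.stanleyReisnerIdeal K := fun f => by
    rw [X_mul_mem_stanleyReisnerIdeal_iff, mem_stanleyReisnerIdeal_iff]
    simp only [hT]
  have hle : Δ.stanleyReisnerIdeal K ≤ D.stanleyReisnerIdeal K := fun f hf => by
    rw [mem_stanleyReisnerIdeal_iff] at hf ⊢
    exact fun m hm h => hf m hm ((hD _).mp h).1
  have hdel : D.stanleyReisnerIdeal K ≤
      Δ.stanleyReisnerIdeal K ⊔ Ideal.span {(X x : MvPolynomial V K)} := by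
    refine Ideal.span_le.mpr ?_
    rintro _ ⟨F, hF, rfl⟩
    by_cases hFΔ : F ∈ Δ.faces
    · have hx : x ∈ F := by
        by_contra h
        exact hF ((hD F).mpr ⟨hFΔ, h⟩)
      exact Ideal.mem_sup_right (Ideal.mem_span_singleton.mpr (Finset.dvd_prod_of_mem _ hx))
    · exact Ideal.mem_sup_left (Ideal.subset_span ⟨F, hFΔ, rfl⟩)
  have hXx : (X x : MvPolynomial V K) ∈ D.stanleyReisnerIdeal K :=
    Ideal.subset_span ⟨{x}, fun h => ((hD _).mp h).2 (Finset.mem_singleton_self x), by simp⟩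
  let φ : T.StanleyReisnerRing K →ₗ[MvPolynomial V K] Δ.StanleyReisnerRing K :=
    Submodule.mapQ _ _ (LinearMap.mulLeft (MvPolynomial V K) (X x)) fun f hf => (hstar f).mpr hf
  let ψ : Δ.StanleyReisnerRing K →ₗ[MvPolynomial V K] D.StanleyReisnerRing K :=
    Submodule.mapQ _ _ LinearMap.id hle
  have hφ : ∀ f, φ (Ideal.Quotient.mk _ f) = Ideal.Quotient.mk _ (X x * f) := fun f => rfl
  have hψ : ∀ f, ψ (Ideal.Quotient.mk _ f) = Ideal.Quotient.mk _ f := fun f => rfl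
  refine Module.Projective.of_exact (f := φ.restrictScalars A) (g := ψ.restrictScalars A)
    ?_ ?_ ?_
  · refine (injective_iff_map_eq_zero φ).mpr fun f => ?_
    obtain ⟨f, rfl⟩ := Ideal.Quotient.mk_surjective f
    rw [hφ, Ideal.Quotient.eq_zero_iff_mem, Ideal.Quotient.eq_zero_iff_mem]
    exact (hstar f).mp
  · intro f
    obtain ⟨f, rfl⟩ := Ideal.Quotient.mk_surjective f
    change ψ _ = 0 ↔ _ ∈ Set.range φ
    rw [hψ, Ideal.Quotient.eq_zero_iff_mem]
    constructor
    · intro hf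
      obtain ⟨a, ha, b, hb, rfl⟩ := Submodule.mem_sup.mp (hdel hf)
      obtain ⟨c, rfl⟩ := Ideal.mem_span_singleton.mp hb
      refine ⟨Ideal.Quotient.mk _ c, ?_⟩
      rw [hφ, map_add, Ideal.Quotient.eq_zero_iff_mem.mpr ha, zero_add]
    · rintro ⟨g, hg⟩
      obtain ⟨g, rfl⟩ := Ideal.Quotient.mk_surjective g
      rw [hφ, Ideal.Quotient.eq] at hg
      have := Ideal.sub_mem _ (Ideal.mul_mem_right g _ hXx) (hle hg)
      simpa using this
  · intro f
    obtain ⟨f, rfl⟩ := Ideal.Quotient.mk_surjective f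
    exact ⟨Ideal.Quotient.mk _ f, hψ f⟩

end FaceComplex

/-! ## The Boolean graph is Cohen–Macaulay -/

namespace booleanGraph

open MvPolynomial

variable {n : ℕ}

/-- The vertices that contain `i`, which represent the complementary pairs. -/
abbrev PairIndex (i : Fin n) : Type := {A : BooleanVertex n // i ∈ A.1}

/-- The member of the pair of `A` that contains `i`. -/
def pairOf (i : Fin n) (A : BooleanVertex n) : PairIndex i :=
  if h : i ∈ A.1 then ⟨A, h⟩ else ⟨A.compl, Finset.mem_compl.mpr h⟩

theorem pairOf_coe {i : Fin n} (A : PairIndex i) : pairOf i A = A := by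
  simp [pairOf, A.2]

theorem pairOf_compl (i : Fin n) (A : BooleanVertex n) : pairOf i A.compl = pairOf i A := by
  by_cases h : i ∈ A.1
  · have h' : i ∉ A.compl.1 := fun h' => Finset.mem_compl.mp h' h
    simp [pairOf, h, h']
  · have h' : i ∈ A.compl.1 := Finset.mem_compl.mpr h
    simp [pairOf, h, h']

/-- The sums `X A + X Aᶜ` over the complementary pairs, as a map from the polynomial ring with one
variable for each pair. -/
noncomputable def pairSum (K : Type v) [Field K] (i : Fin n) :
    MvPolynomial (PairIndex i) K →ₐ[K] MvPolynomial (BooleanVertex n) K :=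
  aeval fun A => X A.1 + X A.1.compl

theorem pairSum_X_pairOf (K : Type v) [Field K] (i : Fin n) (A : BooleanVertex n) :
    pairSum K i (X (pairOf i A)) = X A + X A.compl := by
  rw [pairSum, aeval_X]
  by_cases h : i ∈ A.1
  · simp [pairOf, h]
  · simp [pairOf, h, add_comm]

/-- The polynomial ring of the vertices as an algebra over the polynomial ring of the pairs. -/
noncomputable abbrev pairAlgebra (K : Type v) [Field K] (i : Fin n) :
    Algebra (MvPolynomial (PairIndex i) K) (MvPolynomial (BooleanVertex n) K) :=
  (pairSum K i).toRingHom.toAlgebra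

attribute [local instance] pairAlgebra

theorem projective_stanleyReisnerRing_of_transversal (K : Type v) [Field K] (i : Fin n)
    {W : Finset (BooleanVertex n)} (hW : ∀ A, A ∈ W ↔ A.compl ∉ W)
    (hind : ∀ A ∈ W, ∀ B ∈ W, ¬ (booleanGraph n).Adj A B) :
    Module.Projective (MvPolynomial (PairIndex i) K)
      (((booleanGraph n).indepFaceComplexOn W).StanleyReisnerRing K) := by
  set I := ((booleanGraph n).indepFaceComplexOn W).stanleyReisnerIdeal K with hI
  -- The inverse of the structure map: of each pair only the member in `W` survives, and it goes to
  -- the variable of the pair.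
  let g : MvPolynomial (BooleanVertex n) K →ₐ[K] MvPolynomial (PairIndex i) K :=
    aeval fun A => if A ∈ W then X (pairOf i A) else 0
  have hgX : ∀ A, g (X A) = if A ∈ W then X (pairOf i A) else 0 := fun A => aeval_X _ _
  have hgI : ∀ f ∈ I, g f = 0 := by
    intro f hf
    suffices h : I ≤ RingHom.ker g from h hf
    refine Ideal.span_le.mpr ?_
    rintro _ ⟨F, hF, rfl⟩
    have : ∃ A ∈ F, A ∉ W := by
      by_contra! h
      exact hF ⟨h, fun a ha b hb => hind a (h a ha) b (h b hb)⟩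
    obtain ⟨A, hA, hAW⟩ := this
    change g _ = 0
    rw [map_prod]
    exact Finset.prod_eq_zero hA (by rw [hgX, if_neg hAW])
  have hXI : ∀ A ∉ W, (X A : MvPolynomial (BooleanVertex n) K) ∈ I := by
    intro A hA
    exact Ideal.subset_span ⟨{A}, fun h => hA (h.1 (Finset.mem_singleton_self A)), by simp⟩
  have hleft : ∀ a, g (pairSum K i a) = a := by
    intro a
    suffices h : g.comp (pairSum K i) = AlgHom.id K _ from DFunLike.congr_fun h a
    refine algHom_ext fun A => ?_
    have hp : pairSum K i (X A) = X A.1 + X A.1.compl := aeval_X _ _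
    rw [AlgHom.comp_apply, hp, map_add, hgX, hgX, pairOf_compl, pairOf_coe]
    by_cases hA : A.1 ∈ W
    · simp [hA, (hW A.1).mp hA]
    · have : A.1.compl ∈ W := by
        by_contra h
        exact hA ((hW A.1).mpr h)
      simp [hA, this]
  have hright : ∀ f, Ideal.Quotient.mk I (pairSum K i (g f)) = Ideal.Quotient.mk I f := by
    intro f
    suffices h : ((Ideal.Quotient.mkₐ K I).comp (pairSum K i)).comp g = Ideal.Quotient.mkₐ K I from
      DFunLike.congr_fun h f
    refine algHom_ext fun A => ?_
    rw [AlgHom.comp_apply, AlgHom.comp_apply, hgX]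
    change Ideal.Quotient.mk I _ = Ideal.Quotient.mk I _
    by_cases hA : A ∈ W
    · rw [if_pos hA, pairSum_X_pairOf, map_add,
        Ideal.Quotient.eq_zero_iff_mem.mpr (hXI _ ((hW A).mp hA)), add_zero]
    · rw [if_neg hA, map_zero, map_zero, Ideal.Quotient.eq_zero_iff_mem.mpr (hXI _ hA)]
  have hbij : Function.Bijective (Algebra.linearMap (MvPolynomial (PairIndex i) K)
      (MvPolynomial (BooleanVertex n) K ⧸ I)) := by
    constructor
    · refine (injective_iff_map_eq_zero _).mpr fun a ha => ?_
      have ha' : Ideal.Quotient.mk I (pairSum K i a) = 0 := ha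
      rw [← hleft a]
      exact hgI _ (Ideal.Quotient.eq_zero_iff_mem.mp ha')
    · intro f
      obtain ⟨f, rfl⟩ := Ideal.Quotient.mk_surjective f
      exact ⟨g f, hright f⟩
  exact Module.Projective.of_equiv (LinearEquiv.ofBijective _ hbij)

theorem projective_stanleyReisnerRing (K : Type v) [Field K] (i : Fin n) :
    Module.Projective (MvPolynomial (PairIndex i) K)
      ((booleanGraph n).indepFaceComplex.StanleyReisnerRing K) := by
  rw [SimpleGraph.indepFaceComplex_eq_indepFaceComplexOn_univ]
  refine peel_induction (n := n) (motive := fun W => Module.Projective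
    (MvPolynomial (PairIndex i) K)
      (((booleanGraph n).indepFaceComplexOn W).StanleyReisnerRing K))
    (fun W hW hind => projective_stanleyReisnerRing_of_transversal K i hW hind) ?_
  intro W x hx _ _ hdel hstar
  refine FaceComplex.projective_stanleyReisnerRing_of_star_of_deletion _ x
    (T := (booleanGraph n).indepFaceComplexOn (W.filter (¬ (booleanGraph n).Adj x ·)))
    (D := (booleanGraph n).indepFaceComplexOn (W.erase x))
    (fun F => (SimpleGraph.insert_mem_indepFaceComplexOn _ hx).symm) (fun F => ?_)
  rw [← SimpleGraph.deletion_indepFaceComplexOn]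
  rfl

theorem isIntegral_stanleyReisnerRing (K : Type v) [Field K] (i : Fin n) :
    Algebra.IsIntegral (MvPolynomial (PairIndex i) K)
      ((booleanGraph n).indepFaceComplex.StanleyReisnerRing K) := by
  set I := (booleanGraph n).indepFaceComplex.stanleyReisnerIdeal K with hI
  have hX : ∀ A, IsIntegral (MvPolynomial (PairIndex i) K)
      (Ideal.Quotient.mk I (X A)) := by
    intro A
    have hmem : (X A * X A.compl : MvPolynomial (BooleanVertex n) K) ∈ I := by
      refine Ideal.subset_span ⟨{A, A.compl}, ?_, (Finset.prod_pair A.compl_ne.symm).symm⟩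
      rw [SimpleGraph.indepFaceComplex_eq_indepFaceComplexOn_univ]
      exact fun h => h.2 A (by simp) A.compl (by simp) (adj_compl_self A)
    -- With `y = X A + X Aᶜ`, the value of `t * (t - y)` at `X A` is `-(X A * X Aᶜ)`, which vanishes
    -- on the edge.
    refine ⟨Polynomial.X * (Polynomial.X - Polynomial.C (X (pairOf i A))),
      Polynomial.monic_X.mul (Polynomial.monic_X_sub_C _), ?_⟩
    have hmap : algebraMap (MvPolynomial (PairIndex i) K)
        (MvPolynomial (BooleanVertex n) K ⧸ I) (X (pairOf i A)) =
        Ideal.Quotient.mk I (X A + X A.compl) := by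
      rw [← pairSum_X_pairOf K i A]
      rfl
    rw [Polynomial.eval₂_mul, Polynomial.eval₂_sub, Polynomial.eval₂_X, Polynomial.eval₂_C, hmap,
      ← map_sub, ← map_mul, Ideal.Quotient.eq_zero_iff_mem]
    have : (X A * (X A - (X A + X A.compl)) : MvPolynomial (BooleanVertex n) K) =
      -(X A * X A.compl) := by ring
    rw [this]
    exact I.neg_mem hmem
  refine ⟨fun f => ?_⟩
  obtain ⟨f, rfl⟩ := Ideal.Quotient.mk_surjective f
  induction f using MvPolynomial.induction_on with
  | C a =>
    have : Ideal.Quotient.mk I (C a) = algebraMap (MvPolynomial (PairIndex i) K)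
        (MvPolynomial (BooleanVertex n) K ⧸ I) (C a) := by
      have h : pairSum K i (C a) = C a := (pairSum K i).commutes a
      rw [← h]
      rfl
    rw [this]
    exact isIntegral_algebraMap
  | add p q hp hq =>
    rw [map_add]
    exact hp.add hq
  | mul_X p A hp =>
    rw [map_mul]
    exact hp.mul (hX A)

theorem isCohenMacaulayOver (hn : 1 ≤ n) (K : Type v) [Field K] :
    (booleanGraph n).IsCohenMacaulayOver K := by
  -- Any element serves to select a representative of each pair; `1 ≤ n` provides one.
  let i : Fin n := ⟨0, hn⟩
  have := projective_stanleyReisnerRing K i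
  have := isIntegral_stanleyReisnerRing K i
  exact IsCohenMacaulayRing.of_flat_of_isIntegral
    (MvPolynomial.isCohenMacaulayRing (Field.isCohenMacaulayRing K) (PairIndex i))

end booleanGraph

theorem theorem2p2 (n : ℕ) (hn : 1 ≤ n) :
    (booleanGraph n).IsVertexDecomposable ∧
      ∀ (K : Type u) [Field K], (booleanGraph n).IsCohenMacaulayOver K :=
  ⟨booleanGraph.isVertexDecomposable n, fun K _ => booleanGraph.isCohenMacaulayOver hn K⟩
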